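/- All paratopological groups (groups with a topology making multiplication jointly continuous) are assumed to be $T_0$. For a paratopological group $G$, let $G^\sharp$ be its group coreflection, i.e. the same group with the topological group topology whose neighborhood base at the identity consists of the sets $V\cap V^{-1}$, $V$ a neighborhood of the identity of $G$. The Raĭkov completion $\breve G$ of $G$ is the paratopological group, unique up to topological isomorphism over $G$, that contains $G$ as a topological subgroup dense in $\breve G^\sharp$ and for which $\breve G^\sharp$ is complete in its two-sided uniformity. Let $\mathcal C$ be the class of continuous homomorphisms from sequentially compact topological groups to paratopological groups. A paratopological group $\widetilde G\supseteq G$ (with $G$ a topological subgroup) is a $\mathcal C$-semicompletion of $G$ if every homomorphism $h\colon X\to G$ in $\mathcal C$ extends uniquely to a continuous homomorphism $\breve X\to\widetilde G$; and $\mathcal C[G)$ is the smallest $\mathcal C$-semicompletion $K$ of $G$ with $G\subseteq K\subseteq\breve G$, that is, the intersection of all of them. Let $\mathbb T$ be the circle group, $e$ the identity of $\mathbb T^{\omega_1}$ and $\Sigma=\{x\in\mathbb T^{\omega_1}: |\{\alpha\in\omega_1: x_\alpha\ne 1\}|\le\omega\}$. There exist elements $c\in\mathbb T^{\omega_1}$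 of infinite order with $\langle c\rangle\cap\Sigma=\{e\}$, and for every such $c$ the following hold. 1. The sets $O_U=\bigcup_{n\ge 0}(c^nU\cap\Sigma)\times\{n\}$, where $U$ runs over the open neighborhoods of $e$ in $\mathbb T^{\omega_1}$, form a base of open neighborhoods at the identity for a Hausdorff paratopological group topology on the abelian group $G=\Sigma\times\mathbb Z$. 2. The Raĭkov completion $\breve G$ of $G$ exists, the smallest $\mathcal C$-semicompletion $\mathcal C[G)$ of $G$ in $\breve G$ exists, $\mathcal C[G)=\breve G$, and $\mathcal C[G)$ is not a $T_1$-space. 3. The subgroup $H=\Sigma\times\{0\}$ of $G$ is a sequentially compact, $\omega$-bounded topological group (the closure in $H$ of every countable subset of $H$ is compact). 4. The closure of $H$ in $G$ is $\Sigma\times\{0,-1,-2,\dots\}$, which is not a subgroup of $G$. -/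

import Mathlib

open Topology
open scoped Pointwise

universe u

/-! ### Paratopological groups, group coreflection, Raikov completion -/

/-- A paratopological group: a group with a `T₀` topology for which the multiplication is
(jointly) continuous. -/
class ParatopologicalGroup (G : Type*) [Group G] [TopologicalSpace G] : Prop
    extends ContinuousMul G, T0Space G

/-- The underlying group of the group coreflection of `G`; it carries a different topology. -/
def Sharp (G : Type*) : Type _ := G

namespace Sharp

instance instGroup {G : Type*} [Group G] : Group (Sharp G) := inferInstanceAs (Group G)

/-- The identity map from `G` to its group coreflection. -/
def of {G : Type*} [Group G] : G ≃* Sharp G := MulEquiv.refl G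

/-- The topology of the group coreflection: the coarsest topology that contains the topology of
`G` and all the sets `U⁻¹` with `U` open in `G`. -/
instance instTopologicalSpace {G : Type*} [Group G] [t : TopologicalSpace G] :
    TopologicalSpace (Sharp G) :=
  t.induced (fun x : Sharp G => of.symm x) ⊓ t.induced (fun x : Sharp G => of.symm x⁻¹)

theorem continuous_iff {G Z : Type*} [Group G] [t : TopologicalSpace G] [tZ : TopologicalSpace Z]
    {f : Z → Sharp G} :
    Continuous f ↔
      Continuous (fun z => of.symm (f z)) ∧ Continuous (fun z => of.symm (f z)⁻¹) := by
  have h1 := @continuous_inf_rng Z (Sharp G) f tZ (t.induced (fun x : Sharp G => of.symm x))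
    (t.induced (fun x : Sharp G => of.symm x⁻¹))
  have h2 := (continuous_induced_rng (t₁ := tZ) (t₂ := t) (f := fun x : Sharp G => of.symm x) (g := f))
  have h3 := (continuous_induced_rng (t₁ := tZ) (t₂ := t) (f := fun x : Sharp G => of.symm x⁻¹) (g := f))
  exact h1.trans (and_congr h2 h3)

instance instIsTopologicalGroup {G : Type*} [Group G] [TopologicalSpace G] [ContinuousMul G] :
    IsTopologicalGroup (Sharp G) := by
  obtain ⟨h1, h2⟩ := continuous_iff.1 (continuous_id (X := Sharp G))
  have h1' : Continuous (fun x : Sharp G => (of.symm x : G)) := h1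
  have h2' : Continuous (fun x : Sharp G => (of.symm x⁻¹ : G)) := h2
  refine { continuous_mul := continuous_iff.2 ⟨?_, ?_⟩
           continuous_inv := continuous_iff.2 ⟨h2', ?_⟩ }
  · simp only [map_mul]
    exact (h1'.comp continuous_fst).mul (h1'.comp continuous_snd)
  · simp only [mul_inv_rev, map_mul]
    exact (h2'.comp continuous_snd).mul (h2'.comp continuous_fst)
  · simpa only [inv_inv] using h1'

end Sharp

/-- The two-sided uniformity of a topological group. -/
@[reducible]
def twoSidedUniformSpace (G : Type*) [Group G] [TopologicalSpace G] [IsTopologicalGroup G] :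
    UniformSpace G :=
  IsTopologicalGroup.leftUniformSpace G ⊓ IsTopologicalGroup.rightUniformSpace G

/-- A topological group is Raikov complete if it is complete in its two-sided uniformity. -/
def RaikovComplete (G : Type*) [Group G] [TopologicalSpace G] [IsTopologicalGroup G] : Prop :=
  @CompleteSpace G (twoSidedUniformSpace G)

/-- `G` is `♯`-complete if its group coreflection is Raikov complete. -/
def SharpComplete (G : Type*) [Group G] [TopologicalSpace G] [ContinuousMul G] : Prop :=
  RaikovComplete (Sharp G)

/-- The paratopological group `B`, with the embedding `i` of `G`, is a Raikov completion of `G`: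
it is `♯`-complete and `i` is a topological isomorphism of `G` onto a `♯`-dense subgroup of `B`.
These properties determine `(B, i)` up to a unique topological isomorphism over `G`. -/
structure IsRaikovCompletion {G B : Type*} [Group G] [TopologicalSpace G] [Group B]
    [TopologicalSpace B] [ParatopologicalGroup B] (i : G →* B) : Prop where
  isEmbedding : IsEmbedding i
  sharpDense : DenseRange (fun g : G => Sharp.of (i g))
  sharpComplete : SharpComplete B

/-! ### Semicompletions -/

/-- A class of continuous homomorphisms between (paratopological) groups. -/
def HomClass : Type (u + 1) :=
  ∀ ⦃X Y : Type u⦄ [Group X] [TopologicalSpace X] [Group Y] [TopologicalSpace Y],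
    (X →ₜ* Y) → Prop

/-- The class of the continuous homomorphisms from sequentially compact topological groups to
paratopological groups (both satisfying `T₀`). -/
def seqCompactHoms : HomClass.{u} :=
  fun X Y _ _ _ _ _ =>
    IsTopologicalGroup X ∧ T0Space X ∧ SeqCompactSpace X ∧ ParatopologicalGroup Y

/-- The group `S`, with the embedding `j` of `G`, is a `C`-semicompletion of `G`: `S` is a
paratopological group containing `G` as a topological subgroup, and every homomorphism
`h : X → G` in the class `C` has a unique extension to a continuous homomorphism from the Raikov
completion of `X` to `S`. -/
structure IsSemicompletion (C : HomClass.{u}) {G S : Type u} [Group G] [TopologicalSpace G]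
    [Group S] [TopologicalSpace S] (j : G →* S) : Prop where
  paratopologicalGroup : ParatopologicalGroup S
  isEmbedding : IsEmbedding j
  existsUnique_extension : ∀ (X : Type u) [Group X] [TopologicalSpace X] [ParatopologicalGroup X]
    (h : X →ₜ* G), C h →
    ∀ (B : Type u) [Group B] [TopologicalSpace B] [ParatopologicalGroup B] (k : X →* B),
      IsRaikovCompletion k → ∃! f : B →ₜ* S, ∀ x : X, f (k x) = j (h x)

/-- The subgroups `K` of `B` that contain (the image under `i` of) `G` and are
`C`-semicompletions of `G`. -/
def semicompletionsIn (C : HomClass.{u}) {G B : Type u} [Group G] [TopologicalSpace G]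
    [Group B] [TopologicalSpace B] (i : G →* B) : Set (Subgroup B) :=
  {K | ∃ hK : ∀ g : G, i g ∈ K, IsSemicompletion C (i.codRestrict K hK)}

/-- The `C`-semicompletion of `G`, as a subgroup of the Raikov completion `i : G →* B` of `G`:
the intersection of all intermediate groups that are `C`-semicompletions of `G`. -/
def semicompletion (C : HomClass.{u}) {G B : Type u} [Group G] [TopologicalSpace G]
    [Group B] [TopologicalSpace B] (i : G →* B) : Subgroup B :=
  sInf (semicompletionsIn C i)

/-- A space is `ω`-bounded if the closure of every countable subset is compact. -/
def OmegaBounded (X : Type*) [TopologicalSpace X] : Prop :=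
  ∀ s : Set X, s.Countable → IsCompact (closure s)

/-! ### The group `Σ × ℤ` -/

/-- The compact group `𝕋^{ω₁}` with the product topology. -/
abbrev TorusPower : Type u := (Ordinal.omega.{u} 1).ToType → Circle

/-- The `Σ`-product in `𝕋^{ω₁}`: the elements with at most countably many coordinates
different from `1`. -/
def sigmaProduct : Subgroup TorusPower.{u} where
  carrier := {x | {a | x a ≠ 1}.Countable}
  one_mem' := by simp
  mul_mem' := by
    intro x y hx hy
    refine (hx.union hy).mono ?_
    intro a ha
    by_contra hcon
    simp only [Set.mem_union, Set.mem_ofPred_eq, not_or, not_not] at hcon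
    exact ha (by simp [hcon.1, hcon.2])
  inv_mem' := by
    intro x hx
    simpa using hx

/-- The group `Σ × ℤ` (with `ℤ` written multiplicatively), whose topology depends on a
parameter `c ∈ 𝕋^{ω₁}`. -/
def SigmaZ (_c : TorusPower.{u}) : Type u := sigmaProduct.{u} × Multiplicative ℤ

namespace SigmaZ

noncomputable instance instCommGroup (c : TorusPower.{u}) : CommGroup (SigmaZ c) :=
  inferInstanceAs (CommGroup (sigmaProduct.{u} × Multiplicative ℤ))

variable {c : TorusPower.{u}}

/-- The component of `g ∈ Σ × ℤ` in `Σ`, as an element of `𝕋^{ω₁}`. -/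
def torusPart (g : SigmaZ c) : TorusPower.{u} := (Prod.fst g : sigmaProduct.{u})

/-- The component of `g ∈ Σ × ℤ` in `ℤ`. -/
def intPart (g : SigmaZ c) : ℤ := Multiplicative.toAdd (Prod.snd g)

/-- The set `O_U`, the union over `n ∈ {0, 1, 2, …}` of the sets `(cⁿU ∩ Σ) × {n}`. -/
def basicNhd (c : TorusPower.{u}) (U : Set TorusPower.{u}) : Set (SigmaZ c) :=
  {g | ∃ n : ℕ, g.torusPart ∈ c ^ n • U ∧ g.intPart = n}

theorem basicNhd_mono {U V : Set TorusPower.{u}} (h : U ⊆ V) : basicNhd c U ⊆ basicNhd c V :=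
  fun _ ⟨n, hn, hk⟩ => ⟨n, Set.smul_set_mono h hn, hk⟩

/-- The topology of `Σ × ℤ`: a set `s` is open if with each of its points `g` it contains
`g * O_U` for some open neighbourhood `U` of the identity of `𝕋^{ω₁}`. -/
instance instTopologicalSpace : TopologicalSpace (SigmaZ c) where
  IsOpen s := ∀ g ∈ s, ∃ U : Set TorusPower.{u}, IsOpen U ∧ 1 ∈ U ∧ g • basicNhd c U ⊆ s
  isOpen_univ := fun _ _ => ⟨Set.univ, isOpen_univ, Set.mem_univ _, Set.subset_univ _⟩
  isOpen_inter := by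
    rintro s t hs ht g ⟨hgs, hgt⟩
    obtain ⟨U, hU, h1U, hUs⟩ := hs g hgs
    obtain ⟨V, hV, h1V, hVt⟩ := ht g hgt
    exact ⟨U ∩ V, hU.inter hV, ⟨h1U, h1V⟩, Set.subset_inter
      ((Set.smul_set_mono (basicNhd_mono Set.inter_subset_left)).trans hUs)
      ((Set.smul_set_mono (basicNhd_mono Set.inter_subset_right)).trans hVt)⟩
  isOpen_sUnion := by
    rintro S hS g ⟨s, hsS, hgs⟩
    obtain ⟨U, hU, h1U, hUs⟩ := hS s hsS g hgs
    exact ⟨U, hU, h1U, hUs.trans (Set.subset_sUnion_of_mem hsS)⟩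

/-- The subgroup `Σ × {0}` of `Σ × ℤ`. -/
def sigmaSubgroup (c : TorusPower.{u}) : Subgroup (SigmaZ c) where
  carrier := {g | g.intPart = 0}
  one_mem' := rfl
  mul_mem' := by
    intro x y hx hy
    change x.intPart + y.intPart = 0
    rw [Set.mem_ofPred_eq] at hx hy
    rw [hx, hy, add_zero]
  inv_mem' := by
    intro x hx
    change -x.intPart = 0
    rw [Set.mem_ofPred_eq] at hx
    rw [hx, neg_zero]

end SigmaZ

open Filter

/-! ### The two-sided uniformity -/

/-! The twist `(x, n) ↦ (x c⁻ⁿ, n)` straightens the topology: it embeds `G` in `𝕋^{ω₁} × ℤ↑`, where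
`ℤ↑` is `ℤ` with its upper sets open, and `O_U` becomes the trace of the box `U × [0, ∞)`
(`SigmaZ.isInducing_toCompletion`). The coreflection of this product is `𝕋^{ω₁}` times discrete `ℤ`.
It is locally compact, hence Raikov complete, and each slice contains a translate of the dense
subgroup `Σ`. So the product is the Raikov completion of `G`; it is not `T₁` because `ℤ↑` is not.
`G` is nevertheless Hausdorff: as `c` has infinite order and `⟨c⟩ ∩ Σ` is trivial, `(x, n) ↦ x c⁻ⁿ`
is a continuous injection into `𝕋^{ω₁}`.

`Σ` is sequentially compact with completion `𝕋^{ω₁}`. A semicompletion inside the completion must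
therefore receive an extension of `Σ ≅ H ⊆ G` to `𝕋^{ω₁}`, and this can only be `t ↦ (t, 0)`. It
thus contains `𝕋^{ω₁} × {0}` and `G`, which together generate everything
(`SigmaZ.eq_top_of_mem_semicompletionsIn`). Conversely, the full completion is a semicompletion by
the universal property of Raikov completions. -/

theorem cauchy_twoSidedUniformSpace_iff {G : Type*} [Group G] [TopologicalSpace G]
    [IsTopologicalGroup G] {F : Filter G} :
    @Cauchy G (twoSidedUniformSpace G) F ↔ F.NeBot ∧
      Tendsto (fun p : G × G => p.1⁻¹ * p.2) (F ×ˢ F) (𝓝 1) ∧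
      Tendsto (fun p : G × G => p.2 * p.1⁻¹) (F ×ˢ F) (𝓝 1) := by
  unfold Cauchy
  rw [tendsto_iff_comap, tendsto_iff_comap]
  exact and_congr_right fun _ => le_inf_iff

theorem toTopologicalSpace_twoSidedUniformSpace (G : Type*) [Group G] [t : TopologicalSpace G]
    [IsTopologicalGroup G] : (twoSidedUniformSpace G).toTopologicalSpace = t := by
  rw [twoSidedUniformSpace, UniformSpace.toTopologicalSpace_inf]
  exact inf_idem t

theorem RaikovComplete.exists_le_nhds {G : Type*} [Group G] [t : TopologicalSpace G]
    [IsTopologicalGroup G] (h : RaikovComplete G) {F : Filter G}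
    (hF : @Cauchy G (twoSidedUniformSpace G) F) : ∃ x, F ≤ 𝓝 x := by
  obtain ⟨x, hx⟩ := @CompleteSpace.complete G (twoSidedUniformSpace G) h F hF
  rw [toTopologicalSpace_twoSidedUniformSpace] at hx
  exact ⟨x, hx⟩

theorem RaikovComplete.of_isCompact_mem_nhds_one {G : Type*} [Group G] [t : TopologicalSpace G]
    [IsTopologicalGroup G] {K : Set G} (hK : IsCompact K) (h1 : K ∈ 𝓝 (1 : G)) :
    RaikovComplete G := by
  have hlc : LocallyCompactSpace G := hK.locallyCompactSpace_of_mem_nhds_of_group h1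
  refine @CompleteSpace.mk G (twoSidedUniformSpace G) fun {F} hF => ?_
  rw [toTopologicalSpace_twoSidedUniformSpace]
  let := IsTopologicalGroup.rightUniformSpace G
  have : IsRightUniformGroup G := { uniformity_eq := rfl }
  have : CompleteSpace G := IsRightUniformGroup.completeSpace_of_weaklyLocallyCompactSpace
  exact CompleteSpace.complete (hF.mono_uniformSpace inf_le_right)

/-- A continuous homomorphism into a Raikov complete Hausdorff group extends from a dense
subgroup. -/
theorem RaikovComplete.exists_extension {X Y Z : Type*} [Group X] [TopologicalSpace X]
    [Group Y] [TopologicalSpace Y] [IsTopologicalGroup Y]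
    [Group Z] [TopologicalSpace Z] [IsTopologicalGroup Z] [T0Space Z] (hZ : RaikovComplete Z)
    (k : X →* Y) (hk : IsDenseInducing k) (φ : X →* Z) (hφ : Continuous φ) :
    ∃ f : Y →* Z, Continuous f ∧ ∀ x, f (k x) = φ x := by
  have hφ1 : Tendsto φ (comap k (𝓝 1)) (𝓝 1) := by
    have h := hφ.tendsto 1
    rwa [hk.nhds_eq_comap, map_one, map_one] at h
  have hlim : ∀ y : Y, ∃ z, Tendsto φ (comap k (𝓝 y)) (𝓝 z) := by
    intro y
    have : (comap k (𝓝 y)).NeBot := hk.comap_nhds_neBot y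
    have htk : Tendsto k (comap k (𝓝 y)) (𝓝 y) := tendsto_comap
    apply hZ.exists_le_nhds
    -- The trace of `𝓝 y` is Cauchy on both sides, since quotients of points near `y` tend to `1`; a
    -- continuous homomorphism preserves this.
    rw [cauchy_twoSidedUniformSpace_iff, prod_map_map_eq, tendsto_map'_iff, tendsto_map'_iff]
    refine ⟨inferInstance, ?_, ?_⟩
    · have h : Tendsto (fun p : X × X => p.1⁻¹ * p.2)
          (comap k (𝓝 y) ×ˢ comap k (𝓝 y)) (comap k (𝓝 1)) := by
        rw [tendsto_comap_iff]
        have := ((htk.comp tendsto_fst).inv.mul (htk.comp tendsto_snd) :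
          Tendsto _ (comap k (𝓝 y) ×ˢ comap k (𝓝 y)) _)
        rw [inv_mul_cancel] at this
        exact this.congr fun p => by simp
      exact (hφ1.comp h).congr fun p => by simp
    · have h : Tendsto (fun p : X × X => p.2 * p.1⁻¹)
          (comap k (𝓝 y) ×ˢ comap k (𝓝 y)) (comap k (𝓝 1)) := by
        rw [tendsto_comap_iff]
        have := ((htk.comp tendsto_snd).mul (htk.comp tendsto_fst).inv :
          Tendsto _ (comap k (𝓝 y) ×ˢ comap k (𝓝 y)) _)
        rw [mul_inv_cancel] at this
        exact this.congr fun p => by simp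
      exact (hφ1.comp h).congr fun p => by simp
  have hcont : Continuous (hk.extend φ) := hk.continuous_extend hlim
  have hext : ∀ x, hk.extend φ (k x) = φ x := hk.extend_eq hφ
  refine ⟨MonoidHom.mk' (hk.extend φ) fun a b => ?_, hcont, hext⟩
  refine hk.dense.induction_on₂ (p := fun a b =>
    hk.extend φ (a * b) = hk.extend φ a * hk.extend φ b) ?_ ?_ a b
  · exact isClosed_eq (hcont.comp continuous_mul)
      ((hcont.comp continuous_fst).mul (hcont.comp continuous_snd))
  · intro x y
    rw [← map_mul, hext, hext, hext, map_mul]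

/-! ### The group coreflection -/

namespace Sharp

theorem continuous_of_symm {G : Type*} [Group G] [TopologicalSpace G] :
    Continuous (fun x : Sharp G => (of.symm x : G)) :=
  (continuous_iff.1 continuous_id).1

/-- The homomorphism between the group coreflections induced by a homomorphism. -/
def map {G H : Type*} [Group G] [Group H] (f : G →* H) : Sharp G →* Sharp H :=
  (of.toMonoidHom.comp f).comp of.symm.toMonoidHom

theorem continuous_map {G H : Type*} [Group G] [TopologicalSpace G] [Group H]
    [TopologicalSpace H] {f : G →* H} (hf : Continuous f) : Continuous (map f) :=
  continuous_iff.2 ⟨hf.comp continuous_of_symm, by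
    refine (hf.comp (continuous_iff.1 (continuous_id (X := Sharp G))).2).congr fun x => ?_
    exact _root_.map_inv f _⟩

theorem isInducing_map {G H : Type*} [Group G] [tG : TopologicalSpace G] [Group H]
    [tH : TopologicalSpace H] {f : G →* H} (hf : IsInducing f) : IsInducing (map f) := by
  constructor
  unfold instTopologicalSpace
  rw [induced_inf, induced_compose, induced_compose, hf.eq_induced, induced_compose,
    induced_compose]
  congr 2
  funext x
  exact _root_.map_inv f _

instance instT0Space {G : Type*} [Group G] [TopologicalSpace G] [T0Space G] :
    T0Space (Sharp G) :=
  t0Space_of_injective_of_continuous (f := fun x : Sharp G => (of.symm x : G))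
    (fun _ _ h => h) continuous_of_symm

theorem continuous_of {G : Type*} [Group G] [TopologicalSpace G] [ContinuousInv G] :
    Continuous (of : G → Sharp G) :=
  continuous_iff.2 ⟨continuous_id, continuous_inv (G := G)⟩

end Sharp

/-! ### The universal property of Raikov completions -/

namespace IsRaikovCompletion

variable {G B Z : Type*} [Group G] [TopologicalSpace G] [Group B] [TopologicalSpace B]
  [ParatopologicalGroup B] [Group Z] [TopologicalSpace Z] [ParatopologicalGroup Z] {i : G →* B}

theorem isDenseInducing_map (hi : IsRaikovCompletion i) : IsDenseInducing (Sharp.map i) :=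
  ⟨Sharp.isInducing_map hi.isEmbedding.isInducing, hi.sharpDense⟩

/-- `Z` is only `T₀`, so limits in it need not be unique. The comparison takes place in `Sharp Z`,
which is a `T₀` topological group and hence Hausdorff. -/
theorem ext (hi : IsRaikovCompletion i) {f g : B →* Z} (hf : Continuous f) (hg : Continuous g)
    (h : ∀ x, f (i x) = g (i x)) : f = g := by
  have := hi.isDenseInducing_map.dense.equalizer (Sharp.continuous_map hf)
    (Sharp.continuous_map hg) (funext fun x => h x)
  exact MonoidHom.ext fun b => congrFun this b

/-- A homomorphism that is continuous on the group coreflection and on the dense subgroup `G`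
is continuous. -/
theorem continuous_of_sharp (hi : IsRaikovCompletion i) {f : B →* Z}
    (hf : Continuous (Sharp.map f)) (hfi : Continuous fun g => f (i g)) : Continuous f := by
  suffices h1 : Tendsto f (𝓝 1) (𝓝 1) by
    refine continuous_iff_continuousAt.2 fun b => ?_
    have hb : Tendsto (fun x => b⁻¹ * x) (𝓝 b) (𝓝 1) := by
      simpa using (continuous_const_mul b⁻¹).tendsto b
    simpa [ContinuousAt, Function.comp_def] using (h1.comp hb).const_mul (f b)
  intro V hV
  obtain ⟨W, hWo, hW1, hWV⟩ := exists_open_nhds_one_mul_subset hV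
  have h1 : (fun g => f (i g)) ⁻¹' W ∈ 𝓝 (1 : G) :=
    hfi.continuousAt (hWo.mem_nhds (by simpa using hW1))
  rw [hi.isEmbedding.nhds_eq_comap, map_one] at h1
  obtain ⟨O', hO', hOW⟩ := h1
  obtain ⟨O, hOO', hO, h1O⟩ := mem_nhds_iff.1 hO'
  refine mem_map.2 (mem_of_superset (hO.mem_nhds h1O) fun b hb => ?_)
  -- Density in the coreflection gives `g ∈ G` with `i g ∈ O` and `f (b (i g)⁻¹) ∈ W`: both
  -- conditions are `♯`-open in `y` and hold at `y = b`. Then `f b = f (b (i g)⁻¹) f (i g)` lies in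
  -- `W * W`.
  have hopen : IsOpen {y : Sharp B | (Sharp.of.symm y : B) ∈ O ∧
      (Sharp.of.symm (Sharp.map f (Sharp.of b * y⁻¹)) : Z) ∈ W} := by
    refine (hO.preimage Sharp.continuous_of_symm).inter (hWo.preimage ?_)
    exact Sharp.continuous_of_symm.comp (hf.comp (continuous_const.mul continuous_inv))
  obtain ⟨g, hgO, hgW⟩ := hi.sharpDense.exists_mem_open hopen
    ⟨Sharp.of b, hb, by rw [mul_inv_cancel, map_one]; exact hW1⟩
  have hgW' : f (b * (i g)⁻¹) ∈ W := hgW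
  have : f b = f (b * (i g)⁻¹) * f (i g) := by rw [← map_mul, inv_mul_cancel_right]
  exact hWV (this ▸ Set.mul_mem_mul hgW' (hOW (hOO' hgO)))

theorem existsUnique_extension (hi : IsRaikovCompletion i) (hZ : SharpComplete Z) {φ : G →* Z}
    (hφ : Continuous φ) : ∃! f : B →ₜ* Z, ∀ g, f (i g) = φ g := by
  obtain ⟨f, hf, hfi⟩ := RaikovComplete.exists_extension hZ _ hi.isDenseInducing_map
    (Sharp.map φ) (Sharp.continuous_map hφ)
  let f' : B →* Z := (Sharp.of.symm.toMonoidHom.comp f).comp Sharp.of.toMonoidHom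
  have hf' : ∀ g, f' (i g) = φ g := hfi
  have hc : Continuous f' := hi.continuous_of_sharp (f := f') hf (by simpa only [hf'] using hφ)
  refine ⟨⟨f', hc⟩, hf', fun g hg => ?_⟩
  apply ContinuousMonoidHom.toMonoidHom_injective
  exact hi.ext g.continuous_toFun hc fun x => (hg x).trans (hf' x).symm

/-- Two Raikov completions of the same group are isomorphic over it. -/
theorem exists_isomorphism (hi : IsRaikovCompletion i) {j : G →* Z} (hj : IsRaikovCompletion j) :
    ∃ e : B ≃ₜ* Z, ∀ g, e (i g) = j g := by
  obtain ⟨f, hf, -⟩ := hi.existsUnique_extension hj.sharpComplete hj.isEmbedding.continuous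
  obtain ⟨g, hg, -⟩ := hj.existsUnique_extension hi.sharpComplete hi.isEmbedding.continuous
  have hgf : g.toMonoidHom.comp f.toMonoidHom = MonoidHom.id B :=
    hi.ext (g.continuous_toFun.comp f.continuous_toFun) continuous_id fun x =>
      (congrArg g (hf x)).trans (hg x)
  have hfg : f.toMonoidHom.comp g.toMonoidHom = MonoidHom.id Z :=
    hj.ext (f.continuous_toFun.comp g.continuous_toFun) continuous_id fun x =>
      (congrArg f (hg x)).trans (hf x)
  exact ⟨{ MonoidHom.toMulEquiv f.toMonoidHom g.toMonoidHom hgf hfg with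
    continuous_toFun := f.continuous_toFun
    continuous_invFun := g.continuous_toFun }, hf⟩

end IsRaikovCompletion

/-! ### The whole completion as a semicompletion -/

instance Subgroup.instParatopologicalGroup {G : Type*} [Group G] [TopologicalSpace G]
    [ParatopologicalGroup G] (K : Subgroup G) : ParatopologicalGroup K where
  continuous_mul := K.toSubmonoid.continuousMul.continuous_mul

theorem top_mem_semicompletionsIn (C : HomClass.{u}) {G B : Type u} [Group G]
    [TopologicalSpace G] [Group B] [TopologicalSpace B] [ParatopologicalGroup B] {i : G →* B}
    (hi : IsRaikovCompletion i) : ⊤ ∈ semicompletionsIn C i := by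
  refine ⟨fun _ => Subgroup.mem_top _, inferInstance, ?_, ?_⟩
  · exact hi.isEmbedding.codRestrict _ _
  · intro X _ _ _ h _ Y _ _ _ k hk
    obtain ⟨f, hf, huniq⟩ := hk.existsUnique_extension hi.sharpComplete
      (φ := i.comp h.toMonoidHom) (hi.isEmbedding.continuous.comp h.continuous_toFun)
    refine ⟨⟨f.toMonoidHom.codRestrict ⊤ fun _ => Subgroup.mem_top _,
      f.continuous_toFun.subtype_mk _⟩, fun x => Subtype.ext (hf x), fun g hg => ?_⟩
    have := huniq ⟨(Subgroup.subtype ⊤).comp g.toMonoidHom,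
      continuous_subtype_val.comp g.continuous_toFun⟩ fun x => congrArg Subtype.val (hg x)
    ext b
    exact DFunLike.congr_fun this b

/-! ### The `Σ`-product -/

/-- Extension by `1` of a family indexed by a countable set, as an element of the `Σ`-product. -/
noncomputable def extendSigma (A : Set (Ordinal.omega.{u} 1).ToType) (hA : A.Countable)
    (y : A → Circle) : sigmaProduct.{u} :=
  open Classical in
  ⟨fun a => if h : a ∈ A then y ⟨a, h⟩ else 1, hA.mono fun a ha => by
    by_contra h
    exact ha (dif_neg h)⟩

theorem continuous_extendSigma {A : Set (Ordinal.omega.{u} 1).ToType} (hA : A.Countable) :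
    Continuous (extendSigma A hA) := by
  refine Continuous.subtype_mk (continuous_pi fun a => ?_) _
  by_cases h : a ∈ A
  · simpa only [dif_pos h] using continuous_apply _
  · simpa only [dif_neg h] using continuous_const

theorem mem_range_extendSigma {A : Set (Ordinal.omega.{u} 1).ToType} (hA : A.Countable)
    {x : sigmaProduct.{u}} (hx : {a | x.1 a ≠ 1} ⊆ A) : x ∈ Set.range (extendSigma A hA) := by
  refine ⟨fun a => x.1 a, Subtype.ext (funext fun a => ?_)⟩
  by_cases h : a ∈ A
  · exact dif_pos h
  · exact (dif_neg h).trans (not_not.1 fun h' => h (hx (Ne.symm h')))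

/-- Countably many elements of `Σ` have their supports in one countable set `A`, so they lie in a
copy of `𝕋^A`, which is compact and metrizable. Sequential compactness and `ω`-boundedness of `Σ`
both follow. -/
theorem exists_isCompact_isSeqCompact_superset {s : Set sigmaProduct.{u}} (hs : s.Countable) :
    ∃ K, IsCompact K ∧ IsSeqCompact K ∧ s ⊆ K := by
  have hA : (⋃ x ∈ s, {a | x.1 a ≠ 1}).Countable := hs.biUnion fun x _ => x.2
  have := hA.to_subtype
  refine ⟨Set.range (extendSigma _ hA), isCompact_range (continuous_extendSigma hA),
    IsSeqCompact.range (continuous_extendSigma hA).seqContinuous, fun x hx => ?_⟩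
  exact mem_range_extendSigma hA (Set.subset_biUnion_of_mem (u := fun x : sigmaProduct.{u} =>
    {a | x.1 a ≠ 1}) hx)

instance : SeqCompactSpace sigmaProduct.{u} where
  isSeqCompact_univ := fun x _ => by
    obtain ⟨K, -, hK, hxK⟩ := exists_isCompact_isSeqCompact_superset (Set.countable_range x)
    obtain ⟨a, -, ha⟩ := hK fun n => hxK (Set.mem_range_self n)
    exact ⟨a, Set.mem_univ _, ha⟩

theorem omegaBounded_sigmaProduct : OmegaBounded sigmaProduct.{u} := fun s hs => by
  obtain ⟨K, hK, -, hsK⟩ := exists_isCompact_isSeqCompact_superset hs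
  exact hK.closure_of_subset hsK

theorem dense_sigmaProduct : Dense (sigmaProduct.{u} : Set TorusPower.{u}) := by
  classical
  intro t
  -- The truncations of `t` to finite sets of coordinates lie in `Σ` and converge to `t`.
  have ht : Tendsto (fun F : Finset (Ordinal.omega.{u} 1).ToType => fun a =>
      if a ∈ F then t a else 1) atTop (𝓝 t) := by
    refine tendsto_pi_nhds.2 fun a => tendsto_const_nhds.congr' ?_
    filter_upwards [eventually_ge_atTop {a}] with F hF
    rw [if_pos (hF (Finset.mem_singleton_self a))]
  refine mem_closure_of_tendsto ht (Eventually.of_forall fun F => ?_)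
  refine F.countable_toSet.mono fun a ha => ?_
  by_contra h
  exact ha (if_neg h)

theorem isRaikovCompletion_subtype_sigmaProduct :
    haveI : ParatopologicalGroup TorusPower.{u} := {}
    IsRaikovCompletion sigmaProduct.{u}.subtype := by
  have : ParatopologicalGroup TorusPower.{u} := {}
  refine ⟨IsEmbedding.subtypeVal, ?_, ?_⟩
  · exact (Sharp.of (G := TorusPower.{u})).surjective.denseRange.comp
      dense_sigmaProduct.denseRange_val Sharp.continuous_of
  · refine RaikovComplete.of_isCompact_mem_nhds_one
      (isCompact_range (Sharp.continuous_of (G := TorusPower.{u}))) ?_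
    rw [(Sharp.of (G := TorusPower.{u})).surjective.range_eq]
    exact univ_mem

theorem Circle.exp_one_zpow_ne_one {n : ℤ} (hn : n ≠ 0) : Circle.exp 1 ^ n ≠ 1 := by
  rw [← Circle.exp_zsmul, ← Circle.exp_zero, Ne, Circle.exp_eq_exp]
  rintro ⟨m, hm⟩
  have hm' : (n : ℝ) = m * (2 * Real.pi) := by simpa using hm
  have hm0 : m ≠ 0 := by
    rintro rfl
    exact hn (by simpa using hm')
  have : Irrational ((m * 2 : ℤ) * Real.pi) :=
    irrational_pi.intCast_mul (mul_ne_zero hm0 two_ne_zero)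
  exact this.ne_int n (by rw [hm']; push_cast; ring)

theorem uncountable_toType_omega_one : Uncountable (Ordinal.omega.{u} 1).ToType := by
  rw [← Cardinal.aleph0_lt_mk_iff, Cardinal.mk_toType, Ordinal.card_omega]
  exact Cardinal.aleph0_lt_aleph_one

theorem exists_zpowers_inf_sigmaProduct_eq_bot :
    ∃ c : TorusPower.{u}, ¬ IsOfFinOrder c ∧ Subgroup.zpowers c ⊓ sigmaProduct.{u} = ⊥ := by
  have := uncountable_toType_omega_one.{u}
  -- The witness is constant with value `exp i`, of infinite order because `π` is irrational. Each
  -- nonzero power differs from `1` at all of the uncountably many coordinates.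
  have hne : ∀ n : ℤ, n ≠ 0 → (fun _ => Circle.exp 1 : TorusPower.{u}) ^ n ∉ sigmaProduct.{u} := by
    intro n hn h
    refine Set.not_countable_univ (h.mono fun a _ => ?_)
    exact Circle.exp_one_zpow_ne_one hn
  refine ⟨fun _ => Circle.exp 1, ?_, ?_⟩
  · rw [isOfFinOrder_iff_zpow_eq_one]
    rintro ⟨n, hn, h⟩
    exact hne n hn (h ▸ one_mem _)
  · refine (Subgroup.eq_bot_iff_forall _).2 ?_
    rintro _ ⟨⟨n, rfl⟩, hn⟩
    by_contra h
    refine hne n ?_ hn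
    rintro rfl
    exact h (zpow_zero _)

/-! ### The Raikov completion of `Σ × ℤ` -/

/-- The group `ℤ`, written multiplicatively, with the topology of the upper sets. -/
def UpperInt : Type := Multiplicative ℤ

namespace UpperInt

/-- The integer underlying an element of `UpperInt`. -/
def toInt (n : UpperInt) : ℤ := Multiplicative.toAdd (n : Multiplicative ℤ)

/-- An integer as an element of `UpperInt`. -/
def ofInt (n : ℤ) : UpperInt := (Multiplicative.ofAdd n : Multiplicative ℤ)

instance : CommGroup UpperInt := inferInstanceAs (CommGroup (Multiplicative ℤ))
instance : LinearOrder UpperInt := inferInstanceAs (LinearOrder (Multiplicative ℤ))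
instance : IsOrderedMonoid UpperInt := inferInstanceAs (IsOrderedMonoid (Multiplicative ℤ))
instance : TopologicalSpace UpperInt := Topology.upperSet UpperInt
instance : Topology.IsUpperSet UpperInt := ⟨rfl⟩

instance : ParatopologicalGroup UpperInt where
  continuous_mul := continuous_iff_continuousAt.2 fun p => by
    rw [ContinuousAt, nhds_prod_eq, IsUpperSet.nhds_eq_principal_Ici,
      IsUpperSet.nhds_eq_principal_Ici, IsUpperSet.nhds_eq_principal_Ici,
      prod_principal_principal, tendsto_principal_principal]
    intro q hq
    exact Set.mem_Ici.2 (mul_le_mul' (Set.mem_Ici.1 hq.1) (Set.mem_Ici.1 hq.2))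
  t0 := fun a b h => le_antisymm (IsUpperSet.specializes_iff_le.1 h.symm.specializes)
    (IsUpperSet.specializes_iff_le.1 h.specializes)

end UpperInt

instance : ParatopologicalGroup (TorusPower.{u} × UpperInt) where

theorem hasBasis_nhds_torusPower_prod_upperInt (p : TorusPower.{u} × UpperInt) :
    (𝓝 p).HasBasis (fun U : Set TorusPower.{u} => IsOpen U ∧ 1 ∈ U)
      (fun U => p • (U ×ˢ Set.Ici (1 : UpperInt))) := by
  refine ⟨fun s => ⟨fun hs => ?_, ?_⟩⟩
  · have h1 : (fun q => p * q) ⁻¹' s ∈ 𝓝 (1 : TorusPower.{u} × UpperInt) :=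
      (continuous_const_mul p).continuousAt (by simpa using hs)
    -- `Set.Ici 1` is the least neighbourhood of `1` in `UpperInt`, so only the torus factor varies
    -- in the basis.
    rw [Prod.one_eq_mk, nhds_prod_eq, IsUpperSet.nhds_eq_principal_Ici (1 : UpperInt),
      mem_prod_principal] at h1
    obtain ⟨U, hUs, hU, h1U⟩ := mem_nhds_iff.1 h1
    refine ⟨U, ⟨hU, h1U⟩, ?_⟩
    rintro _ ⟨q, hq, rfl⟩
    exact hUs hq.1 q.2 hq.2
  · rintro ⟨U, ⟨hU, h1U⟩, hUs⟩
    have h1 : U ×ˢ Set.Ici (1 : UpperInt) ∈ 𝓝 (p⁻¹ * p) := by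
      rw [inv_mul_cancel]
      refine prod_mem_nhds (hU.mem_nhds h1U) ?_
      rw [IsUpperSet.nhds_eq_principal_Ici]
      exact mem_principal_self _
    filter_upwards [(continuous_const_mul p⁻¹).continuousAt h1] with q hq
    exact hUs (Set.mem_smul_set_iff_inv_smul_mem.2 hq)

namespace SigmaZ

variable {c : TorusPower.{u}}

theorem torusPart_mul (g h : SigmaZ c) : (g * h).torusPart = g.torusPart * h.torusPart := rfl

theorem intPart_mul (g h : SigmaZ c) : (g * h).intPart = g.intPart + h.intPart := rfl

/-- The element of `Σ × ℤ` with the given components. -/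
def mk (c : TorusPower.{u}) (x : sigmaProduct.{u}) (n : ℤ) : SigmaZ c :=
  (x, Multiplicative.ofAdd n)

@[simp] theorem torusPart_mk (x : sigmaProduct.{u}) (n : ℤ) : (mk c x n).torusPart = x := rfl

@[simp] theorem intPart_mk (x : sigmaProduct.{u}) (n : ℤ) : (mk c x n).intPart = n := rfl

/-- The embedding `(x, n) ↦ (x c⁻ⁿ, n)` of `Σ × ℤ` in its Raikov completion. -/
noncomputable def toCompletion (c : TorusPower.{u}) : SigmaZ c →* TorusPower.{u} × UpperInt where
  toFun g := (g.torusPart * c ^ (-g.intPart), UpperInt.ofInt g.intPart)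
  map_one' := Prod.ext (by change (1 : TorusPower.{u}) * c ^ (-0 : ℤ) = 1; simp) rfl
  map_mul' g h := Prod.ext (by
    change _ = g.torusPart * c ^ (-g.intPart) * (h.torusPart * c ^ (-h.intPart))
    rw [torusPart_mul, intPart_mul, neg_add, zpow_add, mul_mul_mul_comm]) rfl

theorem toCompletion_apply (g : SigmaZ c) : toCompletion c g =
    (g.torusPart * c ^ (-g.intPart), UpperInt.ofInt g.intPart) := rfl

theorem basicNhd_eq_preimage (U : Set TorusPower.{u}) :
    basicNhd c U = toCompletion c ⁻¹' (U ×ˢ Set.Ici (1 : UpperInt)) := by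
  ext g
  have key : ∀ n : ℕ, g.intPart = n →
      (g.torusPart ∈ c ^ n • U ↔ g.torusPart * c ^ (-g.intPart) ∈ U) := by
    intro n hn
    rw [hn, Set.mem_smul_set_iff_inv_smul_mem, smul_eq_mul, mul_comm, zpow_neg, zpow_natCast]
  constructor
  · rintro ⟨n, hn, hk⟩
    refine ⟨(key n hk).1 hn, ?_⟩
    change (0 : ℤ) ≤ g.intPart
    omega
  · rintro ⟨hU, hn⟩
    obtain ⟨n, hn⟩ := Int.eq_ofNat_of_zero_le (show (0 : ℤ) ≤ g.intPart from hn)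
    exact ⟨n, (key n hn).2 hU, hn⟩

theorem smul_basicNhd_eq_preimage (g : SigmaZ c) (U : Set TorusPower.{u}) :
    g • basicNhd c U =
      toCompletion c ⁻¹' (toCompletion c g • (U ×ˢ Set.Ici (1 : UpperInt))) := by
  ext h
  rw [Set.mem_smul_set_iff_inv_smul_mem, basicNhd_eq_preimage, Set.mem_preimage,
    Set.mem_preimage, Set.mem_smul_set_iff_inv_smul_mem, smul_eq_mul, smul_eq_mul, map_mul,
    map_inv]

/-- The topology of `SigmaZ c` is given by its open sets, so it is not immediate that `g • basicNhd
c U` is a neighbourhood of `g`. Being induced from a product settles this and also yields joint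
continuity of multiplication. -/
theorem isInducing_toCompletion : IsInducing (toCompletion c) := by
  constructor
  refine TopologicalSpace.ext_iff.2 fun s => ?_
  let := TopologicalSpace.induced (toCompletion c) inferInstance
  refine Iff.trans ?_ isOpen_iff_mem_nhds.symm
  refine forall₂_congr fun g _ => ?_
  rw [nhds_induced, ((hasBasis_nhds_torusPower_prod_upperInt _).comap _).mem_iff]
  refine exists_congr fun U => ?_
  rw [smul_basicNhd_eq_preimage, and_assoc]

theorem hasBasis_nhds (g : SigmaZ c) :
    (𝓝 g).HasBasis (fun U : Set TorusPower.{u} => IsOpen U ∧ 1 ∈ U)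
      (fun U => g • basicNhd c U) := by
  rw [isInducing_toCompletion.nhds_eq_comap]
  simp only [smul_basicNhd_eq_preimage]
  exact (hasBasis_nhds_torusPower_prod_upperInt _).comap _

theorem isOpen_basicNhd {U : Set TorusPower.{u}} (hU : IsOpen U) : IsOpen (basicNhd c U) := by
  rw [basicNhd_eq_preimage]
  exact (hU.prod (IsUpperSet.isOpen_iff_isUpperSet.2 (isUpperSet_Ici _))).preimage
    isInducing_toCompletion.continuous

theorem continuous_fst_toCompletion : Continuous fun g : SigmaZ c => (toCompletion c g).1 :=
  continuous_fst.comp isInducing_toCompletion.continuous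

theorem injective_toCompletion : Function.Injective (toCompletion c) := by
  intro g h hgh
  have hi : g.intPart = h.intPart :=
    congrArg (fun p : TorusPower.{u} × UpperInt => p.2.toInt) hgh
  have ht : g.torusPart * c ^ (-g.intPart) = h.torusPart * c ^ (-h.intPart) :=
    congrArg (fun p : TorusPower.{u} × UpperInt => p.1) hgh
  rw [hi] at ht
  exact Prod.ext (Subtype.ext (mul_right_cancel ht)) hi

/-- A kernel element `(x, n)` has `x = cⁿ ∈ ⟨c⟩ ∩ Σ`, which forces `x = 1` and then `n = 0`. This
gives the Hausdorff property. -/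
theorem injective_fst_toCompletion (hc : ¬ IsOfFinOrder c)
    (hcs : Subgroup.zpowers c ⊓ sigmaProduct.{u} = ⊥) :
    Function.Injective fun g : SigmaZ c => (toCompletion c g).1 := by
  suffices h : Function.Injective
      ((MonoidHom.fst TorusPower.{u} UpperInt).comp (toCompletion c)) from h
  rw [injective_iff_map_eq_one]
  intro g hg
  have hg' : g.torusPart * c ^ (-g.intPart) = 1 := hg
  rw [zpow_neg, mul_inv_eq_one] at hg'
  have hmem : c ^ g.intPart ∈ Subgroup.zpowers c ⊓ sigmaProduct.{u} :=
    ⟨⟨_, rfl⟩, hg' ▸ (Prod.fst g).2⟩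
  rw [hcs, Subgroup.mem_bot] at hmem
  have h0 : g.intPart = 0 := by
    by_contra h
    exact hc (isOfFinOrder_iff_zpow_eq_one.2 ⟨_, h, hmem⟩)
  exact Prod.ext (Subtype.ext (hg'.trans hmem)) h0

instance instParatopologicalGroup : ParatopologicalGroup (SigmaZ c) where
  toContinuousMul := isInducing_toCompletion.continuousMul (toCompletion c)
  t0 := (t0Space_of_injective_of_continuous injective_toCompletion
    isInducing_toCompletion.continuous).t0

theorem isRaikovCompletion_toCompletion : IsRaikovCompletion (toCompletion c) := by
  have hcont : ∀ n : UpperInt, Continuous fun t : TorusPower.{u} => Sharp.of (t, n) := fun n =>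
    Sharp.continuous_iff.2 ⟨continuous_id.prodMk continuous_const,
      continuous_inv.prodMk (continuous_const (y := n⁻¹))⟩
  refine ⟨⟨isInducing_toCompletion, injective_toCompletion⟩, ?_, ?_⟩
  · rintro ⟨t, n⟩
    -- The points of `G` at level `n` form the translate `Σ c⁻ⁿ`, dense in `𝕋^{ω₁}`.
    have hd : t ∈ closure ((fun x : TorusPower.{u} => x * c ^ (-n.toInt)) ''
        sigmaProduct.{u}) := by
      exact (Homeomorph.mulRight (c ^ (-n.toInt))).surjective.denseRange.dense_image
        (Homeomorph.mulRight _).continuous dense_sigmaProduct t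
    refine closure_mono ?_ (image_closure_subset_closure_image (hcont n) ⟨t, hd, rfl⟩)
    rintro _ ⟨_, ⟨x, hx, rfl⟩, rfl⟩
    exact ⟨mk c ⟨x, hx⟩ n.toInt, rfl⟩
  · refine RaikovComplete.of_isCompact_mem_nhds_one (isCompact_range (hcont 1)) ?_
    -- In the coreflection both `n ≥ 0` and `-n ≥ 0` are open conditions, so the compact slice over
    -- `0` is a neighbourhood of the identity.
    have ho : IsOpen {p : TorusPower.{u} × UpperInt | 1 ≤ p.2} :=
      (IsUpperSet.isOpen_iff_isUpperSet.2 (isUpperSet_Ici _)).preimage continuous_snd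
    have hc1 := (ho.preimage Sharp.continuous_of_symm).mem_nhds
      (show (1 : Sharp (TorusPower.{u} × UpperInt)) ∈ _ from le_refl (1 : UpperInt))
    have hc2 := ((ho.preimage Sharp.continuous_of_symm).preimage continuous_inv).mem_nhds
      (show (1 : Sharp (TorusPower.{u} × UpperInt)) ∈ _ from (inv_one (G := UpperInt)).ge)
    filter_upwards [hc1, hc2]
    rintro ⟨t, n⟩ h1 h2
    have h1' : 1 ≤ n := h1
    have h2' : 1 ≤ n⁻¹ := h2
    obtain rfl : n = 1 := le_antisymm (one_le_inv'.1 h2') h1'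
    exact ⟨t, rfl⟩

/-- The topological isomorphism of the `Σ`-product onto the subgroup `Σ × {0}`. -/
noncomputable def sigmaSubgroupEquiv (c : TorusPower.{u}) :
    sigmaProduct.{u} ≃ₜ* sigmaSubgroup c where
  toFun x := ⟨mk c x 0, rfl⟩
  invFun g := Prod.fst g.1
  left_inv _ := rfl
  right_inv g := Subtype.ext (Prod.ext rfl g.2.symm)
  map_mul' _ _ := rfl
  continuous_toFun := by
    refine Continuous.subtype_mk (isInducing_toCompletion.continuous_iff.2 ?_) _
    refine (continuous_subtype_val.prodMk continuous_const).congr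
      (f := fun x : sigmaProduct.{u} => ((x : TorusPower.{u}), (1 : UpperInt))) fun x => ?_
    exact Prod.ext (by simp [toCompletion_apply]) rfl
  continuous_invFun := by
    refine IsInducing.subtypeVal.continuous_iff.2
      ((continuous_fst_toCompletion.comp continuous_subtype_val).congr fun g => ?_)
    have hg : g.1.intPart = 0 := g.2
    simp only [Function.comp_apply, toCompletion_apply, hg, neg_zero, zpow_zero, mul_one]
    rfl

theorem isTopologicalGroup_sigmaSubgroup : IsTopologicalGroup (sigmaSubgroup c) :=
  (sigmaSubgroupEquiv c).symm.toHomeomorph.isInducing.topologicalGroup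
    (sigmaSubgroupEquiv c).symm

theorem seqCompactSpace_sigmaSubgroup : SeqCompactSpace (sigmaSubgroup c) where
  isSeqCompact_univ := by
    rw [← (sigmaSubgroupEquiv c).surjective.range_eq]
    exact IsSeqCompact.range (sigmaSubgroupEquiv c).continuous_toFun.seqContinuous

theorem omegaBounded_sigmaSubgroup : OmegaBounded (sigmaSubgroup c) := fun s hs => by
  have h := omegaBounded_sigmaProduct _ (hs.preimage (sigmaSubgroupEquiv c).injective)
  have h' := h.image (sigmaSubgroupEquiv c).continuous_toFun
  refine h'.of_isClosed_subset isClosed_closure ?_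
  have := (sigmaSubgroupEquiv c).toHomeomorph.image_closure (sigmaSubgroupEquiv c ⁻¹' s)
  refine Eq.subset (Eq.trans ?_ this.symm)
  exact congrArg closure (Set.image_preimage_eq s (sigmaSubgroupEquiv c).surjective).symm

theorem closure_sigmaSubgroup :
    closure (sigmaSubgroup c : Set (SigmaZ c)) = {g | g.intPart ≤ 0} := by
  refine Set.Subset.antisymm (closure_minimal (fun g hg => le_of_eq hg) ?_) fun g hg => ?_
  · have ho : IsClosed {p : TorusPower.{u} × UpperInt | p.2 ≤ 1} :=
      (IsUpperSet.isClosed_iff_isLower.2 (isLowerSet_Iic _)).preimage continuous_snd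
    exact ho.preimage isInducing_toCompletion.continuous
  · rw [mem_closure_iff_nhds_basis (hasBasis_nhds g)]
    rintro U ⟨hU, h1U⟩
    obtain ⟨n, hn⟩ := Int.eq_ofNat_of_zero_le (neg_nonneg.2 (show g.intPart ≤ 0 from hg))
    -- A translate `g * O_U` reaches level `0` through its layer `n = -g.intPart`, and that layer is
    -- nonempty because `Σ` is dense and `cⁿU` is open.
    obtain ⟨x, hx, hxs⟩ := dense_sigmaProduct.inter_open_nonempty (c ^ n • U) (hU.smul _)
      ⟨_, Set.smul_mem_smul_set h1U⟩
    refine ⟨g * mk c ⟨x, hxs⟩ n, ?_, Set.smul_mem_smul_set ⟨n, hx, rfl⟩⟩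
    change g.intPart + n = 0
    omega

theorem not_exists_coe_eq_closure_sigmaSubgroup : ¬ ∃ K : Subgroup (SigmaZ c),
    (K : Set (SigmaZ c)) = closure (sigmaSubgroup c : Set (SigmaZ c)) := by
  rintro ⟨K, hK⟩
  rw [closure_sigmaSubgroup] at hK
  have h1 : mk c 1 (-1) ∈ (K : Set (SigmaZ c)) := by
    rw [hK]
    exact (by decide : (-1 : ℤ) ≤ 0)
  have h2 : (mk c 1 (-1))⁻¹ ∈ (K : Set (SigmaZ c)) := K.inv_mem h1
  rw [hK] at h2
  exact absurd (show -(-1 : ℤ) ≤ 0 from h2) (by decide)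

/-! ### Semicompletions of `Σ × ℤ` and failure of `T₁` -/

/-- A semicompletion of `Σ × ℤ` contains the compact group that completes `Σ × {0}`, hence it is
the whole Raikov completion. -/
theorem eq_top_of_mem_semicompletionsIn {B : Type u} [Group B] [TopologicalSpace B]
    [ParatopologicalGroup B] {i : SigmaZ c →* B} (hi : IsRaikovCompletion i) {K : Subgroup B}
    (hK : K ∈ semicompletionsIn seqCompactHoms.{u} i) : K = ⊤ := by
  have hT : ParatopologicalGroup TorusPower.{u} := {}
  have hS : ParatopologicalGroup sigmaProduct.{u} := {}
  obtain ⟨e, he⟩ := isRaikovCompletion_toCompletion.exists_isomorphism hi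
  obtain ⟨hiK, hsemi⟩ := hK
  let h : sigmaProduct.{u} →ₜ* SigmaZ c :=
    ⟨(sigmaSubgroup c).subtype.comp (sigmaSubgroupEquiv c).toMonoidHom,
      continuous_subtype_val.comp (sigmaSubgroupEquiv c).continuous_toFun⟩
  obtain ⟨f, hf, -⟩ := hsemi.existsUnique_extension sigmaProduct.{u} h
    ⟨inferInstance, inferInstance, inferInstance, inferInstance⟩ TorusPower.{u}
    sigmaProduct.{u}.subtype isRaikovCompletion_subtype_sigmaProduct
  -- Both sides agree on `Σ`, which is dense in `𝕋^{ω₁}`. Hence the extension into `K` is `t ↦ e (t,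
  -- 1)`, and `K` contains the image of the torus.
  have hfe : K.subtype.comp f.toMonoidHom =
      e.toMonoidHom.comp (MonoidHom.inl TorusPower.{u} UpperInt) := by
    refine isRaikovCompletion_subtype_sigmaProduct.ext
      (continuous_subtype_val.comp f.continuous_toFun)
      (e.continuous_toFun.comp (continuous_id.prodMk continuous_const)) fun x => ?_
    refine (congrArg Subtype.val (hf x)).trans ((he (mk c x 0)).symm.trans (congrArg e ?_))
    exact Prod.ext (by simp [toCompletion_apply]) rfl
  refine (Subgroup.eq_top_iff' K).2 fun b => ?_
  obtain ⟨⟨t, n⟩, rfl⟩ := e.surjective b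
  -- The second factor is `(c⁻ⁿ, n)`, the image of `(1, n) ∈ G`; the factor `cⁿ` in the first one
  -- compensates for the twist.
  have hdecomp : ((t, n) : TorusPower.{u} × UpperInt) =
      (t * c ^ n.toInt, 1) * toCompletion c (mk c 1 n.toInt) :=
    Prod.ext (by simp [toCompletion_apply]) (one_mul n).symm
  rw [hdecomp, map_mul, he]
  refine K.mul_mem ?_ (hiK _)
  have := DFunLike.congr_fun hfe (t * c ^ n.toInt)
  exact this ▸ (f (t * c ^ n.toInt)).2

theorem not_t1Space_of_isRaikovCompletion {B : Type u} [Group B] [TopologicalSpace B]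
    [ParatopologicalGroup B] {i : SigmaZ c →* B} (hi : IsRaikovCompletion i) : ¬ T1Space B := by
  intro hB
  obtain ⟨e, -⟩ := isRaikovCompletion_toCompletion.exists_isomorphism hi
  have : T1Space (TorusPower.{u} × UpperInt) := e.symm.toHomeomorph.t1Space
  -- Every neighbourhood of `0` in the upper topology contains `1`, so `1` specializes to `0`; in a
  -- `T₁` space they would coincide.
  have hs : ((1, UpperInt.ofInt 1) : TorusPower.{u} × UpperInt) ⤳
      (1, (1 : UpperInt)) :=
    specializes_rfl.prod (IsUpperSet.specializes_iff_le.2 (by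
      change (0 : ℤ) ≤ 1
      decide))
  have h01 : (1 : ℤ) = 0 := congrArg (fun p : TorusPower.{u} × UpperInt => p.2.toInt) hs.eq
  exact one_ne_zero h01

end SigmaZ

theorem mainTheorem2 :
    -- there are parameters `c` of infinite order with `⟨c⟩ ∩ Σ = {1}`
    (∃ c : TorusPower.{u}, ¬ IsOfFinOrder c ∧ Subgroup.zpowers c ⊓ sigmaProduct.{u} = ⊥) ∧
    -- and for each of them `G = Σ × ℤ` has the following properties
    ∀ c : TorusPower.{u}, ¬ IsOfFinOrder c → Subgroup.zpowers c ⊓ sigmaProduct.{u} = ⊥ →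
      -- `G` is a Hausdorff paratopological (abelian) group with the sets `O_U` as an open base at 1
      (ParatopologicalGroup (SigmaZ c) ∧ T2Space (SigmaZ c) ∧
        (𝓝 (1 : SigmaZ c)).HasBasis (fun U : Set TorusPower.{u} => IsOpen U ∧ 1 ∈ U)
          (SigmaZ.basicNhd c) ∧
        ∀ U : Set TorusPower.{u}, IsOpen U → 1 ∈ U → IsOpen (SigmaZ.basicNhd c U)) ∧
      -- `G` has a Raikov completion
      (∃ (B : Type u) (_ : Group B) (_ : TopologicalSpace B) (_ : ParatopologicalGroup B)
        (i : SigmaZ c →* B), IsRaikovCompletion i) ∧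
      -- the `C`-semicompletion of `G` is its whole Raikov completion and is not a `T₁`-space
      (∀ (B : Type u) [Group B] [TopologicalSpace B] [ParatopologicalGroup B]
        (i : SigmaZ c →* B), IsRaikovCompletion i →
          IsLeast (semicompletionsIn seqCompactHoms.{u} i) (semicompletion seqCompactHoms.{u} i) ∧
          semicompletion seqCompactHoms.{u} i = ⊤ ∧
          ¬ T1Space (semicompletion seqCompactHoms.{u} i)) ∧
      -- `H = Σ × {0}` is an `ω`-bounded sequentially compact topological group
      (IsTopologicalGroup (SigmaZ.sigmaSubgroup c) ∧ SeqCompactSpace (SigmaZ.sigmaSubgroup c) ∧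
        OmegaBounded (SigmaZ.sigmaSubgroup c)) ∧
      -- the closure of `H` in `G` is `Σ × (-ω)`, which is not a subgroup of `G`
      closure (SigmaZ.sigmaSubgroup c : Set (SigmaZ c)) = {g | g.intPart ≤ 0} ∧
      ¬ ∃ K : Subgroup (SigmaZ c),
        (K : Set (SigmaZ c)) = closure (SigmaZ.sigmaSubgroup c : Set (SigmaZ c)) := by
  refine ⟨exists_zpowers_inf_sigmaProduct_eq_bot, fun c hc hcs => ⟨⟨inferInstance, ?_, ?_, ?_⟩,
    ?_, ?_, ?_, SigmaZ.closure_sigmaSubgroup, SigmaZ.not_exists_coe_eq_closure_sigmaSubgroup⟩⟩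
  · exact T2Space.of_injective_continuous (SigmaZ.injective_fst_toCompletion hc hcs)
      SigmaZ.continuous_fst_toCompletion
  · simpa using SigmaZ.hasBasis_nhds (1 : SigmaZ c)
  · exact fun U hU _ => SigmaZ.isOpen_basicNhd hU
  · exact ⟨TorusPower.{u} × UpperInt, inferInstance, inferInstance, inferInstance,
      SigmaZ.toCompletion c, SigmaZ.isRaikovCompletion_toCompletion⟩
  · intro B _ _ _ i hi
    have htop := top_mem_semicompletionsIn seqCompactHoms.{u} hi
    have hsemi : semicompletion seqCompactHoms.{u} i = ⊤ := by
      refine sInf_eq_top.2 fun K hK => ?_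
      exact SigmaZ.eq_top_of_mem_semicompletionsIn hi hK
    rw [hsemi]
    refine ⟨⟨htop, fun K hK => (SigmaZ.eq_top_of_mem_semicompletionsIn hi hK).ge⟩, rfl, ?_⟩
    intro hT1
    refine SigmaZ.not_t1Space_of_isRaikovCompletion hi ?_
    exact t1Space_of_injective_of_continuous (f := fun b : B => (⟨b, Subgroup.mem_top b⟩ :
      (⊤ : Subgroup B))) (fun a b h => congrArg Subtype.val h) (continuous_id.subtype_mk _)
  · exact ⟨SigmaZ.isTopologicalGroup_sigmaSubgroup, SigmaZ.seqCompactSpace_sigmaSubgroup,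
      SigmaZ.omegaBounded_sigmaSubgroup⟩
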